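/- Let $\beta=(\beta_{ij})$ be a doubly stochastic $n\times n$ matrix (real, with nonnegative entries and all row and column sums equal to $1$) and let $\gamma\in[-1,1]$. Let $\beta.*(1-\beta).^{-\gamma}$ denote the $n\times n$ matrix with entries $\beta_{ij}(1-\beta_{ij})^{-\gamma}$, and write $\mathrm{perm}(A)=\sum_{\sigma\in S_n}\prod_{i=1}^n A_{i\sigma(i)}$. Then $$\mathrm{perm}\left(\beta.*(1-\beta).^{-\gamma}\right)\ \ge\ \frac{n!}{n^n}\prod_{i,j=1}^n(1-\beta_{ij})^{-\gamma\beta_{ij}} .$$ Here $0^0=1$. If $\gamma\le 0$, or if no entry of $\beta$ equals $1$, this is an inequality between (finite) real numbers. In general it holds in $[0,+\infty]$, with the conventions $0^{-\gamma}=+\infty$ for $\gamma>0$ and $0\cdot\infty=0$. -/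

import Mathlib

open scoped Nat ENNReal

/-! The theorem follows from Gurvits's capacity inequality: if `∏ i, ∑ j, A i j * x j ≥ c * ∏ j, x
j` for all positive `x`, then `perm A ≥ c * n! / n ^ n`. For `A = β.*w`, weighted AM-GM in each row,
with the column sums, gives `c = ∏ w i j ^ β i j`; then take `w = (1 - β).^(-γ)`.

For capacity, differentiate the product of the row forms in one variable at a time, ending at the
permanent. By Gauss–Lucas the derivatives keep having no zeros with all coordinates in the right
half-plane, so for positive data their restrictions to lines have only negative roots. Such a
polynomial lies below its tangent power function, so the step leaving `k` variables costs at most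
the factor `(k / (k + 1)) ^ k`. These factors multiply to `n! / n ^ n`. -/

/-! ### Univariate polynomials with roots in the left half-plane -/

open Polynomial in
theorem Polynomial.eval_derivative_zero_ne_zero_of_re_nonneg {f : ℂ[X]} (hdeg : 0 < f.degree)
    (hf : ∀ z : ℂ, 0 ≤ z.re → f.eval z ≠ 0) : f.derivative.eval 0 ≠ 0 := by
  intro h0
  have hd : f.derivative ≠ 0 := by
    intro h
    have := Polynomial.derivative_eq_zero.mp h
    rw [← Polynomial.natDegree_pos_iff_degree_pos] at hdeg
    omega
  have hmem : (0 : ℂ) ∈ f.derivative.rootSet ℂ := by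
    rw [Polynomial.mem_rootSet]
    exact ⟨hd, by simpa using h0⟩
  have hsub : convexHull ℝ (f.rootSet ℂ) ⊆ {z : ℂ | z.re < 0} := by
    refine convexHull_min (fun z hz => ?_) (convex_halfSpace_re_lt 0)
    rw [Polynomial.mem_rootSet] at hz
    by_contra hz0
    exact hf z (not_lt.mp hz0) (by simpa using hz.2)
  simpa using hsub (Polynomial.rootSet_derivative_subset_convexHull_rootSet hdeg hmem)

theorem Multiset.prod_le_sum_div_card_pow (s : Multiset ℝ) (hs : ∀ x ∈ s, 0 ≤ x) :
    s.prod ≤ (s.sum / s.card) ^ s.card := by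
  induction s using Quotient.inductionOn with
  | h l =>
  simp only [Multiset.quot_mk_to_coe, Multiset.prod_coe, Multiset.sum_coe, Multiset.coe_card]
  rcases Nat.eq_zero_or_pos l.length with h0 | hpos
  · simp [List.length_eq_zero_iff.mp h0]
  have hl : ∀ i : Fin l.length, 0 ≤ l.get i := fun i => hs _ (by simp)
  have key := Real.geom_mean_le_arith_mean Finset.univ (fun _ : Fin l.length => (1 : ℝ)) l.get
    (by simp) (by simpa using hpos) (by simpa using hl)
  have hsum : ∑ i : Fin l.length, l.get i = l.sum := by
    rw [← List.sum_ofFn, List.ofFn_get]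
  have hprod : ∏ i : Fin l.length, l.get i = l.prod := by
    rw [← List.prod_ofFn, List.ofFn_get]
  simp only [Real.rpow_one, one_mul, Finset.sum_const, Finset.card_univ, Fintype.card_fin,
    nsmul_eq_mul, mul_one, hsum, hprod] at key
  have hp0 : 0 ≤ l.prod := hprod ▸ Finset.prod_nonneg fun i _ => hl i
  calc l.prod = (l.prod ^ ((l.length : ℝ)⁻¹)) ^ l.length :=
        (Real.rpow_inv_natCast_pow hp0 hpos.ne').symm
    _ ≤ _ := pow_le_pow_left₀ (Real.rpow_nonneg hp0 _) key _

open Polynomial in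
/-- A polynomial all of whose complex roots are negative reals lies below the power function
that is tangent to it at `0`. -/
theorem Polynomial.eval_le_of_roots_neg {f : ℝ[X]} (h0 : 0 < f.eval 0)
    (hroots : ∀ z : ℂ, (f.map (algebraMap ℝ ℂ)).eval z = 0 → z.im = 0 ∧ z.re < 0)
    {t : ℝ} (ht : 0 ≤ t) :
    f.eval t ≤
      f.eval 0 * (1 + t * (f.derivative.eval 0 / f.eval 0) / f.natDegree) ^ f.natDegree := by
  have hf0 : f ≠ 0 := by rintro rfl; simp at h0
  have hsp : f.Splits := by
    refine Polynomial.Splits.of_splits_map (algebraMap ℝ ℂ) (IsAlgClosed.splits _) ?_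
    intro a ha
    have := hroots a (Polynomial.isRoot_of_mem_roots ha)
    exact ⟨a.re, Complex.ext (by simp) (by simp [this.1])⟩
  have hneg : ∀ r ∈ f.roots, r < 0 := by
    intro r hr
    have h1 : f.eval r = 0 := Polynomial.isRoot_of_mem_roots hr
    have := hroots (algebraMap ℝ ℂ r) (by rw [Polynomial.eval_map_apply, h1, map_zero])
    simpa using this.2
  have hder := hsp.eval_derivative_div_eval_of_ne_zero h0.ne'
  have hcard : f.roots.card = f.natDegree := hsp.natDegree_eq_card_roots.symm
  -- AM-GM applies to these factors, since the `1 / (0 - r)` sum to `f'(0) / f(0)`.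
  have heval : f.eval t = f.eval 0 * (f.roots.map fun r => 1 + t * (1 / (0 - r))).prod := by
    rw [hsp.eval_eq_prod_roots t, hsp.eval_eq_prod_roots 0, mul_assoc, ← Multiset.prod_map_mul]
    congr 2
    refine Multiset.map_congr rfl fun r hr => ?_
    have := (hneg r hr).ne
    field_simp
    ring
  rw [heval]
  refine mul_le_mul_of_nonneg_left ?_ h0.le
  rcases Nat.eq_zero_or_pos f.natDegree with hd | hd
  · have : f.roots = 0 := by rw [← Multiset.card_eq_zero, hcard, hd]
    simp [this, hd]
  refine (Multiset.prod_le_sum_div_card_pow _ ?_).trans_eq ?_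
  · intro x hx
    obtain ⟨r, hr, rfl⟩ := Multiset.mem_map.mp hx
    have : 0 ≤ 1 / (0 - r) := by have := hneg r hr; exact one_div_nonneg.mpr (by linarith)
    positivity
  · rw [Multiset.card_map, hcard, Multiset.sum_map_add, Multiset.sum_map_mul_left, ← hder]
    simp only [Multiset.map_const', Multiset.sum_replicate, hcard, nsmul_eq_mul, mul_one]
    congr 1
    field_simp

/-! ### Directional derivatives of a product of coordinates -/

section MixedPermanent

variable {ι R S : Type*} [Fintype ι] [DecidableEq ι] [CommSemiring R] [CommSemiring S] {m : ℕ}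

/-- The polynomial obtained from `∏ i, y i` by differentiating in the directions `a j`. -/
noncomputable def mixedPermanent (a : Fin m → ι → R) (y : ι → R) : R :=
  ∑ f : Fin m ↪ ι, (∏ j, a j (f j)) * ∏ i ∈ (Finset.univ.map f)ᶜ, y i

theorem map_mixedPermanent (g : R →+* S) (a : Fin m → ι → R) (y : ι → R) :
    g (mixedPermanent a y) = mixedPermanent (fun j i => g (a j i)) (fun i => g (y i)) := by
  simp [mixedPermanent, map_sum, map_prod]

theorem card_compl_univ_map (f : Fin m ↪ ι) :
    (Finset.univ.map f)ᶜ.card = Fintype.card ι - m := by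
  simp [Finset.card_compl]

theorem mixedPermanent_mul (a : Fin m → ι → R) (y : ι → R) (c : R) :
    mixedPermanent a (fun i => c * y i) = c ^ (Fintype.card ι - m) * mixedPermanent a y := by
  simp only [mixedPermanent, Finset.mul_sum, Finset.prod_mul_distrib, Finset.prod_const,
    card_compl_univ_map]
  exact Finset.sum_congr rfl fun f _ => by ring

open Polynomial in
/-- The restriction of `mixedPermanent a` to the line through `y` in the direction `b`. -/
noncomputable def mixedPermanentLine (a : Fin m → ι → R) (y b : ι → R) : R[X] :=
  mixedPermanent (fun j i => C (a j i)) (fun i => C (b i) * X + C (y i))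

open Polynomial in
theorem eval_mixedPermanentLine (a : Fin m → ι → R) (y b : ι → R) (t : R) :
    (mixedPermanentLine a y b).eval t = mixedPermanent a (fun i => b i * t + y i) := by
  rw [mixedPermanentLine, ← Polynomial.coe_evalRingHom, map_mixedPermanent]
  simp

theorem map_mixedPermanentLine (g : R →+* S) (a : Fin m → ι → R) (y b : ι → R) :
    (mixedPermanentLine a y b).map g =
      mixedPermanentLine (fun j i => g (a j i)) (fun i => g (y i)) (fun i => g (b i)) := by
  rw [mixedPermanentLine, ← Polynomial.coe_mapRingHom, map_mixedPermanent]
  simp [mixedPermanentLine]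

theorem natDegree_mixedPermanentLine_le (a : Fin m → ι → R) (y b : ι → R) :
    (mixedPermanentLine a y b).natDegree ≤ Fintype.card ι - m := by
  refine Polynomial.natDegree_sum_le_of_forall_le _ _ fun f _ => ?_
  rw [← map_prod Polynomial.C]
  refine (Polynomial.natDegree_C_mul_le _ _).trans ((Polynomial.natDegree_prod_le _ _).trans ?_)
  rw [← card_compl_univ_map f, Finset.card_eq_sum_ones]
  exact Finset.sum_le_sum fun i _ => Polynomial.natDegree_linear_le

theorem coeff_mixedPermanentLine (a : Fin m → ι → R) (y b : ι → R) :
    (mixedPermanentLine a y b).coeff (Fintype.card ι - m) = mixedPermanent a b := by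
  simp only [mixedPermanentLine, mixedPermanent, Polynomial.finsetSum_coeff]
  refine Finset.sum_congr rfl fun f _ => ?_
  rw [← map_prod Polynomial.C, Polynomial.coeff_C_mul]
  congr 1
  have := Polynomial.coeff_prod_of_natDegree_le (s := (Finset.univ.map f)ᶜ)
    (fun i => Polynomial.C (b i) * Polynomial.X + Polynomial.C (y i)) 1
    (fun i _ => Polynomial.natDegree_linear_le)
  rw [card_compl_univ_map, mul_one] at this
  rw [this]
  simp [Polynomial.coeff_C]

/-- An embedding of `Fin (m + 1)` is an embedding of `Fin m` together with a point outside its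
range. -/
theorem mixedPermanent_cons (a : Fin m → ι → R) (b y : ι → R) :
    mixedPermanent (Fin.cons b a) y =
      ∑ f : Fin m ↪ ι, (∏ j, a j (f j)) *
        ∑ i ∈ (Finset.univ.map f)ᶜ, b i * ∏ i' ∈ (Finset.univ.map f)ᶜ.erase i, y i' := by
  simp only [mixedPermanent]
  rw [← (Equiv.embeddingFinSucc m ι).symm.sum_comp, Fintype.sum_sigma]
  refine Finset.sum_congr rfl fun f _ => ?_
  rw [Finset.mul_sum]
  rw [Finset.sum_subtype (p := fun i => i ∉ Set.range f) (Finset.univ.map f)ᶜ (by simp)]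
  refine Finset.sum_congr rfl fun i _ => ?_
  have h : ∀ j, (Equiv.embeddingFinSucc m ι).symm ⟨f, i⟩ j = (Fin.cons i.1 f : Fin (m + 1) → ι) j :=
    fun j => congrFun (Equiv.coe_embeddingFinSucc_symm _) j
  have hs : (Finset.univ.map ((Equiv.embeddingFinSucc m ι).symm ⟨f, i⟩))ᶜ =
      (Finset.univ.map f)ᶜ.erase i.1 := by
    ext k
    simp [h, Fin.forall_fin_succ, eq_comm]
  rw [hs, Fin.prod_univ_succ]
  simp only [h, Fin.cons_zero, Fin.cons_succ]
  ring

theorem eval_zero_derivative_mixedPermanentLine (a : Fin m → ι → R) (y b : ι → R) :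
    (mixedPermanentLine a y b).derivative.eval 0 = mixedPermanent (Fin.cons b a) y := by
  rw [mixedPermanent_cons, mixedPermanentLine, mixedPermanent, Polynomial.derivative_sum,
    Polynomial.eval_finsetSum]
  refine Finset.sum_congr rfl fun f _ => ?_
  rw [← map_prod Polynomial.C, Polynomial.derivative_C_mul, Polynomial.eval_C_mul,
    Polynomial.derivative_prod_finset, Polynomial.eval_finsetSum]
  congr 1
  refine Finset.sum_congr rfl fun i _ => ?_
  rw [mul_comm]
  simp [Polynomial.eval_prod]

end MixedPermanent

/-! ### Stability and the one-variable capacity step -/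

section Stability

variable {ι : Type*} [Fintype ι] [DecidableEq ι] {m : ℕ}

theorem mixedPermanent_zero_fun {R : Type*} [CommSemiring R] (a : Fin 0 → ι → R) (y : ι → R) :
    mixedPermanent a y = ∏ i, y i := by
  simp [mixedPermanent]

theorem mixedPermanent_pos (hm : m ≤ Fintype.card ι) {a : Fin m → ι → ℝ}
    (ha : ∀ j i, 0 < a j i) {y : ι → ℝ} (hy : ∀ i, 0 < y i) : 0 < mixedPermanent a y := by
  have : Nonempty (Fin m ↪ ι) := Function.Embedding.nonempty_of_card_le (by simpa using hm)
  exact Finset.sum_pos (fun f _ => mul_pos (Finset.prod_pos fun j _ => ha _ _)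
    (Finset.prod_pos fun i _ => hy i)) Finset.univ_nonempty

/-- `mixedPermanent a` has no zeros in the product of open right half-planes. -/
theorem mixedPermanent_ofReal_ne_zero (hm : m ≤ Fintype.card ι) {a : Fin m → ι → ℝ}
    (ha : ∀ j i, 0 < a j i) {z : ι → ℂ} (hz : ∀ i, 0 < (z i).re) :
    mixedPermanent (fun j i => (a j i : ℂ)) z ≠ 0 := by
  induction m generalizing z with
  | zero =>
    rw [mixedPermanent_zero_fun]
    refine Finset.prod_ne_zero_iff.mpr fun i _ h => ?_
    simpa [h] using hz i
  | succ m ih =>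
    have ih' := fun {z : ι → ℂ} => ih (Nat.le_of_succ_le hm) (a := fun j => a j.succ)
      (fun j i => ha _ _) (z := z)
    have hcons : (fun j i => (a j i : ℂ)) =
        Fin.cons (fun i => (a 0 i : ℂ)) (fun (j : Fin m) i => (a j.succ i : ℂ)) := by
      ext j i
      refine Fin.cases ?_ (fun j => ?_) j <;> simp
    rw [hcons, ← eval_zero_derivative_mixedPermanentLine]
    -- Moving from `z` by `w * a 0` with `0 ≤ w.re` stays in the half-planes, so Gauss–Lucas applies
    -- on this line.
    refine Polynomial.eval_derivative_zero_ne_zero_of_re_nonneg ?_ fun w hw => ?_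
    · rw [← Polynomial.natDegree_pos_iff_degree_pos]
      refine lt_of_lt_of_le (Nat.sub_pos_of_lt hm) (Polynomial.le_natDegree_of_ne_zero ?_)
      rw [coeff_mixedPermanentLine]
      exact ih' fun i => by simpa using ha 0 i
    · rw [eval_mixedPermanentLine]
      refine ih' fun i => ?_
      have := mul_nonneg (ha 0 i).le hw
      have := hz i
      simp only [Complex.add_re, Complex.re_ofReal_mul]
      linarith

theorem natDegree_mixedPermanentLine (hm : m ≤ Fintype.card ι) {a : Fin m → ι → ℝ}
    (ha : ∀ j i, 0 < a j i) (y : ι → ℝ) {b : ι → ℝ} (hb : ∀ i, 0 < b i) :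
    (mixedPermanentLine a y b).natDegree = Fintype.card ι - m := by
  refine le_antisymm (natDegree_mixedPermanentLine_le _ _ _)
    (Polynomial.le_natDegree_of_ne_zero ?_)
  rw [coeff_mixedPermanentLine]
  exact (mixedPermanent_pos hm ha hb).ne'

theorem mixedPermanentLine_roots_neg (hm : m ≤ Fintype.card ι) {a : Fin m → ι → ℝ}
    (ha : ∀ j i, 0 < a j i) {y b : ι → ℝ} (hy : ∀ i, 0 < y i) (hb : ∀ i, 0 < b i) (w : ℂ)
    (hw : ((mixedPermanentLine a y b).map (algebraMap ℝ ℂ)).eval w = 0) :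
    w.im = 0 ∧ w.re < 0 := by
  rw [map_mixedPermanentLine, eval_mixedPermanentLine] at hw
  -- By homogeneity a zero may be multiplied by any `s`; this must not bring it into the
  -- half-planes.
  have key : ∀ s : ℂ, 0 < s.re → ¬ 0 ≤ (s * w).re := by
    intro s hs hsw
    refine mixedPermanent_ofReal_ne_zero hm ha (z := fun i => s * (b i * w + y i)) (fun i => ?_) ?_
    · have h1 := mul_nonneg (hb i).le hsw
      have h2 := mul_pos (hy i) hs
      have : (s * (b i * w + y i)).re = b i * (s * w).re + y i * s.re := by
        simp
        ring
      rw [this]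
      linarith
    · rw [mixedPermanent_mul]
      exact mul_eq_zero_of_right _ hw
  have hre : w.re < 0 := by
    by_contra h
    exact key 1 (by simp) (by simpa using h)
  refine ⟨?_, hre⟩
  by_contra him
  -- This is `w.im * I * conj w`, which makes `s * w` purely imaginary.
  refine key ⟨w.im ^ 2, w.re * w.im⟩ (by positivity) (le_of_eq ?_)
  simp
  ring

theorem mixedPermanent_line_le (hm : m ≤ Fintype.card ι) {a : Fin m → ι → ℝ}
    (ha : ∀ j i, 0 < a j i) {y b : ι → ℝ} (hy : ∀ i, 0 < y i) (hb : ∀ i, 0 < b i)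
    {t : ℝ} (ht : 0 ≤ t) :
    mixedPermanent a (fun i => b i * t + y i) ≤ mixedPermanent a y *
      (1 + t * (mixedPermanent (Fin.cons b a) y / mixedPermanent a y) /
        (Fintype.card ι - m : ℕ)) ^ (Fintype.card ι - m) := by
  have h0 : (mixedPermanentLine a y b).eval 0 = mixedPermanent a y := by
    simp [eval_mixedPermanentLine]
  have := Polynomial.eval_le_of_roots_neg (h0 ▸ mixedPermanent_pos hm ha hy)
    (mixedPermanentLine_roots_neg hm ha hy hb) ht
  rwa [h0, eval_mixedPermanentLine, eval_zero_derivative_mixedPermanentLine,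
    natDegree_mixedPermanentLine hm ha y hb] at this

theorem mul_pow_le_mixedPermanent_cons {k : ℕ} (hk : 0 < k) (hm : k + 1 + m = Fintype.card ι)
    {a : Fin m → ι → ℝ} (ha : ∀ j i, 0 < a j i) {y b : ι → ℝ} (hy : ∀ i, 0 < y i)
    (hb : ∀ i, 0 < b i) {c : ℝ}
    (hc : ∀ t, 0 < t → c * t ≤ mixedPermanent a (fun i => b i * t + y i)) :
    c * ((k : ℝ) / (k + 1)) ^ k ≤ mixedPermanent (Fin.cons b a) y := by
  have hM := mixedPermanent_pos (by omega) ha hy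
  have hD : 0 < mixedPermanent (Fin.cons b a : Fin (m + 1) → ι → ℝ) y := by
    refine mixedPermanent_pos (by omega) (fun j => ?_) hy
    refine Fin.cases ?_ (fun j => ?_) j
    · simpa using hb
    · simpa using ha j
  set M := mixedPermanent a y
  set D := mixedPermanent (Fin.cons b a : Fin (m + 1) → ι → ℝ) y
  have hk' : (0 : ℝ) < k := by exact_mod_cast hk
  -- This `t` minimises `(1 + t * D / (M * (k + 1))) ^ (k + 1) / t`.
  have ht : 0 < M * (k + 1) / (D * k) := by positivity
  have h := (hc _ ht).trans (mixedPermanent_line_le (by omega) ha hy hb ht.le)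
  rw [show Fintype.card ι - m = k + 1 by omega] at h
  have h1 : 1 + M * (k + 1) / (D * k) * (D / M) / ((k + 1 : ℕ) : ℝ) = (k + 1) / k := by
    push_cast
    field_simp
  rw [h1, pow_succ] at h
  have h2 : c ≤ D * (((k : ℝ) + 1) / k) ^ k := by
    have h3 : c * (M * (k + 1) / (D * k)) * (D * k / (M * (k + 1))) = c := by field_simp
    rw [← h3]
    refine (mul_le_mul_of_nonneg_right h (by positivity)).trans_eq ?_
    change M * _ * _ = _
    field_simp
  calc c * ((k : ℝ) / (k + 1)) ^ k
      ≤ D * (((k : ℝ) + 1) / k) ^ k * ((k : ℝ) / (k + 1)) ^ k := by gcongr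
    _ = D := by
      rw [mul_assoc, ← mul_pow, div_mul_div_cancel₀ hk'.ne', div_self (by positivity), one_pow,
        mul_one]

/-- The last step: the form is now linear, so its derivative along `b` is its value at `b`. The base
point is `0`, the empty sum of the remaining variables. -/
theorem le_mixedPermanent_cons_zero (hm : 1 + m = Fintype.card ι) (a : Fin m → ι → ℝ)
    (b : ι → ℝ) {c : ℝ} (hc : c ≤ mixedPermanent a b) :
    c ≤ mixedPermanent (Fin.cons b a) 0 := by
  refine hc.trans_eq ?_
  rw [mixedPermanent_cons]
  refine Finset.sum_congr rfl fun f _ => ?_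
  obtain ⟨i, hi⟩ := Finset.card_eq_one.mp
    ((card_compl_univ_map f).trans (show Fintype.card ι - m = 1 by omega))
  simp [hi]

/-- In the induction, the variables with index at least `k` have been differentiated away and `c`
bounds the capacity in the other `k`. -/
theorem factorial_div_pow_mul_le_mixedPermanent {N : ℕ} (hN : N = Fintype.card ι)
    {b : ℕ → ι → ℝ} (hb : ∀ j i, 0 < b j i) (k m : ℕ) (hk : k + m = N) {c : ℝ}
    (hc : ∀ x : ℕ → ℝ, (∀ j, 0 < x j) → c * ∏ j ∈ Finset.range k, x j ≤
      mixedPermanent (fun j : Fin m => b (k + j))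
        (fun i => ∑ j ∈ Finset.range k, b j i * x j)) :
    c * ((k ! : ℝ) / (k : ℝ) ^ k) ≤ mixedPermanent (fun j : Fin N => b j) 0 := by
  induction k generalizing m c with
  | zero =>
    obtain rfl : m = N := by omega
    simpa [Pi.zero_def] using hc 1 (by simp)
  | succ k ih =>
    have hcons : (fun j : Fin (m + 1) => b (k + j)) =
        Fin.cons (b k) (fun j : Fin m => b (k + 1 + j)) := by
      ext j i
      refine Fin.cases ?_ (fun j => ?_) j
      · simp
      · simp [add_assoc, add_comm 1]
    have hline : ∀ x : ℕ → ℝ, (∀ j, 0 < x j) → ∀ t, 0 < t →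
        c * (∏ j ∈ Finset.range k, x j) * t ≤ mixedPermanent (fun j : Fin m => b (k + 1 + j))
          (fun i => b k i * t + ∑ j ∈ Finset.range k, b j i * x j) := by
      intro x hx t ht
      have h := hc (Function.update x k t) (fun j => by
        rcases eq_or_ne j k with rfl | h
        · simpa using ht
        · simpa [h] using hx j)
      have hne : ∀ j ∈ Finset.range k, Function.update x k t j = x j := fun j hj =>
        Function.update_of_ne (Finset.mem_range.mp hj).ne _ _
      simp only [Finset.prod_range_succ, Finset.sum_range_succ, Function.update_self] at h
      rw [Finset.prod_congr rfl hne, ← mul_assoc] at h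
      refine h.trans_eq (congrArg _ (funext fun i => ?_))
      rw [add_comm, Finset.sum_congr rfl fun j hj => by rw [hne j hj]]
    have hstep := ih (m + 1) (by omega) (c := c * ((k : ℝ) / (k + 1)) ^ k) (fun x hx => by
      rw [hcons]
      rcases Nat.eq_zero_or_pos k with rfl | hk0
      · have h := hline x hx 1 one_pos
        simp only [Finset.range_zero, Finset.prod_empty, Finset.sum_empty, mul_one, add_zero,
          pow_zero] at h ⊢
        exact le_mixedPermanent_cons_zero (by omega) _ _ h
      · rw [mul_right_comm]
        refine mul_pow_le_mixedPermanent_cons hk0 (by omega) (fun j i => hb _ _) (fun i => ?_)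
          (hb k) (hline x hx)
        exact Finset.sum_pos (fun j _ => mul_pos (hb _ _) (hx j))
          (Finset.nonempty_range_iff.mpr hk0.ne'))
    -- The constants telescope: `k! / k ^ k * (k / (k + 1)) ^ k = (k + 1)! / (k + 1) ^ (k + 1)`.
    refine le_trans (le_of_eq ?_) hstep
    rw [mul_assoc]
    congr 1
    rw [Nat.factorial_succ, div_pow]
    rcases Nat.eq_zero_or_pos k with rfl | hk0
    · simp
    · have : (0 : ℝ) < k := by exact_mod_cast hk0
      push_cast
      field_simp
      ring

end Stability

theorem mixedPermanent_eq_permanent {R : Type*} [CommSemiring R] {n : ℕ}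
    (A : Matrix (Fin n) (Fin n) R) (y : Fin n → R) :
    mixedPermanent (fun j i => A i j) y = A.permanent := by
  rw [mixedPermanent, Matrix.permanent,
    ← (Equiv.embeddingEquivOfFinite (Fin n)).sum_comp]
  refine Finset.sum_congr rfl fun f _ => ?_
  have : (Finset.univ.map f)ᶜ = ∅ := by
    rw [← Finset.card_eq_zero, card_compl_univ_map]
    simp
  rw [this, Finset.prod_empty, mul_one]
  rfl

/-! ### Capacity inequality for matrices -/

namespace Matrix

variable {n : ℕ} {A : Matrix (Fin n) (Fin n) ℝ} {c : ℝ}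

theorem mul_factorial_div_pow_le_permanent_of_pos (hA : ∀ i j, 0 < A i j)
    (hc : ∀ x : Fin n → ℝ, (∀ j, 0 < x j) → c * ∏ j, x j ≤ ∏ i, ∑ j, A i j * x j) :
    c * ((n ! : ℝ) / (n : ℝ) ^ n) ≤ A.permanent := by
  have h := factorial_div_pow_mul_le_mixedPermanent (ι := Fin n) (by simp)
    (b := fun j i => if h : j < n then A i ⟨j, h⟩ else 1)
    (fun j i => by split_ifs; exacts [hA _ _, one_pos]) n 0 rfl (c := c)
    (fun x hx => by
      rw [mixedPermanent_zero_fun]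
      simp only [Finset.prod_range, Finset.sum_range]
      simpa using hc (fun j => x j) fun j => hx j)
  simpa [mixedPermanent_eq_permanent] using h

/-- **Gurvits's capacity inequality** for the permanent of a nonnegative matrix. -/
theorem mul_factorial_div_pow_le_permanent (hA : ∀ i j, 0 ≤ A i j)
    (hc : ∀ x : Fin n → ℝ, (∀ j, 0 < x j) → c * ∏ j, x j ≤ ∏ i, ∑ j, A i j * x j) :
    c * ((n ! : ℝ) / (n : ℝ) ^ n) ≤ A.permanent := by
  -- Adding `ε > 0` to each entry preserves the capacity bound; then let `ε` tend to `0`.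
  have hcont : Continuous fun ε : ℝ => (of fun i j => A i j + ε).permanent := by
    simp only [permanent, of_apply]
    fun_prop
  have hlim := (hcont.tendsto 0).mono_left (nhdsWithin_le_nhds (s := Set.Ioi 0))
  simp only [add_zero] at hlim
  refine ge_of_tendsto hlim ?_
  filter_upwards [self_mem_nhdsWithin] with ε hε
  have hε : 0 < ε := hε
  refine mul_factorial_div_pow_le_permanent_of_pos (fun i j => ?_) fun x hx => ?_
  · exact add_pos_of_nonneg_of_pos (hA i j) hε
  · refine (hc x hx).trans (Finset.prod_le_prod (fun i _ => ?_) fun i _ => ?_)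
    · exact Finset.sum_nonneg fun j _ => mul_nonneg (hA i j) (hx j).le
    · refine Finset.sum_le_sum fun j _ => mul_le_mul_of_nonneg_right ?_ (hx j).le
      simpa using hε.le

end Matrix

/-! ### Doubly stochastic matrices and infinite values -/

namespace Matrix

variable {n : ℕ} {β : Matrix (Fin n) (Fin n) ℝ}

theorem prod_prod_rpow_mul_le_permanent (hβ : β ∈ doublyStochastic ℝ (Fin n))
    {w : Matrix (Fin n) (Fin n) ℝ} (hw : ∀ i j, 0 ≤ w i j) :
    (∏ i, ∏ j, w i j ^ β i j) * ((n ! : ℝ) / (n : ℝ) ^ n) ≤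
      (of fun i j => β i j * w i j).permanent := by
  have hβ0 : ∀ i j, 0 ≤ β i j := fun i j => nonneg_of_mem_doublyStochastic hβ
  refine mul_factorial_div_pow_le_permanent (fun i j => mul_nonneg (hβ0 i j) (hw i j))
    fun x hx => ?_
  have hx' : ∏ j, x j = ∏ i, ∏ j, x j ^ β i j := by
    rw [Finset.prod_comm]
    refine Finset.prod_congr rfl fun j _ => ?_
    rw [← Real.rpow_sum_of_pos (hx j), sum_col_of_mem_doublyStochastic hβ, Real.rpow_one]
  rw [hx', ← Finset.prod_mul_distrib]
  refine Finset.prod_le_prod (fun i _ => ?_) fun i _ => ?_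
  · exact mul_nonneg (Finset.prod_nonneg fun j _ => Real.rpow_nonneg (hw i j) _)
      (Finset.prod_nonneg fun j _ => Real.rpow_nonneg (hx j).le _)
  · rw [← Finset.prod_mul_distrib]
    refine (Finset.prod_congr rfl fun j _ => (Real.mul_rpow (hw i j) (hx j).le).symm).trans_le ?_
    refine (Real.geom_mean_le_arith_mean_weighted Finset.univ (β i) (fun j => w i j * x j)
      (fun j _ => hβ0 i j) (sum_row_of_mem_doublyStochastic hβ i)
      fun j _ => mul_nonneg (hw i j) (hx j).le).trans_eq ?_
    simp [mul_assoc]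

theorem prod_prod_rpow_le_permanent (hβ : β ∈ doublyStochastic ℝ (Fin n)) (γ : ℝ) :
    ((n ! : ℝ) / (n : ℝ) ^ n) * ∏ i, ∏ j, (1 - β i j) ^ (-γ * β i j) ≤
      (of fun i j => β i j * (1 - β i j) ^ (-γ)).permanent := by
  have h1 : ∀ i j, 0 ≤ 1 - β i j := fun i j => sub_nonneg.mpr (le_one_of_mem_doublyStochastic hβ)
  have := prod_prod_rpow_mul_le_permanent hβ (w := of fun i j => (1 - β i j) ^ (-γ))
    fun i j => Real.rpow_nonneg (h1 i j) _
  simp only [of_apply] at this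
  rw [mul_comm]
  simpa only [Real.rpow_mul (h1 _ _)] using this

/-- The case `γ = 0` makes the permanent of `β` positive, so one of its terms is nonzero. -/
theorem exists_perm_forall_pos (hβ : β ∈ doublyStochastic ℝ (Fin n)) :
    ∃ σ : Equiv.Perm (Fin n), ∀ i, 0 < β (σ i) i := by
  have h := prod_prod_rpow_le_permanent hβ 0
  simp only [neg_zero, zero_mul, Real.rpow_zero, Finset.prod_const_one, mul_one] at h
  have hpos : (0 : ℝ) < (n ! : ℝ) / (n : ℝ) ^ n := by
    rcases Nat.eq_zero_or_pos n with rfl | hn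
    · simp
    · positivity
  obtain ⟨σ, -, hσ⟩ := Finset.exists_ne_zero_of_sum_ne_zero (hpos.trans_le h).ne'
  refine ⟨σ, fun i => (nonneg_of_mem_doublyStochastic hβ).lt_of_ne' ?_⟩
  exact Finset.prod_ne_zero_iff.mp hσ i (Finset.mem_univ i)

theorem eq_of_eq_one_of_pos (hβ : β ∈ doublyStochastic ℝ (Fin n)) {i i' j : Fin n}
    (h : β i j = 1) (h' : 0 < β i' j) : i' = i := by
  by_contra hne
  have h2 : β i j + β i' j ≤ ∑ k, β k j := by
    rw [← Finset.sum_pair (f := fun k => β k j) (Ne.symm hne)]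
    exact Finset.sum_le_sum_of_subset_of_nonneg (Finset.subset_univ _)
      fun _ _ _ => nonneg_of_mem_doublyStochastic hβ
  rw [sum_col_of_mem_doublyStochastic hβ] at h2
  linarith

/-- A positive diagonal must pass through the entry `1`, the only positive one in its column. That
factor is infinite and the others are nonzero. -/
theorem permanent_eq_top_of_eq_one (hβ : β ∈ doublyStochastic ℝ (Fin n)) {γ : ℝ} (hγ : 0 < γ)
    {i j : Fin n} (h : β i j = 1) :
    (of fun i j => ENNReal.ofReal (β i j) * ENNReal.ofReal (1 - β i j) ^ (-γ)).permanent = ⊤ := by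
  obtain ⟨σ, hσ⟩ := exists_perm_forall_pos hβ
  refine ENNReal.sum_eq_top.mpr ⟨σ, Finset.mem_univ _, ?_⟩
  have hi : σ j = i := eq_of_eq_one_of_pos hβ h (hσ j)
  rw [← Finset.mul_prod_erase _ _ (Finset.mem_univ j)]
  have htop : (of fun i j => ENNReal.ofReal (β i j) * ENNReal.ofReal (1 - β i j) ^ (-γ)) (σ j) j =
      ⊤ := by
    simp [hi, h, hγ]
  rw [htop]
  refine ENNReal.top_mul (Finset.prod_ne_zero_iff.mpr fun k _ => mul_ne_zero ?_ ?_)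
  · simpa using hσ k
  · simp [ENNReal.rpow_eq_zero_iff, hγ.not_gt]

theorem ofReal_permanent {m : Type*} [Fintype m] [DecidableEq m] {A : Matrix m m ℝ}
    (hA : ∀ i j, 0 ≤ A i j) :
    ENNReal.ofReal A.permanent = (of fun i j => ENNReal.ofReal (A i j)).permanent := by
  rw [permanent, ENNReal.ofReal_sum_of_nonneg fun σ _ => Finset.prod_nonneg fun i _ => hA _ _]
  refine Finset.sum_congr rfl fun σ _ => ?_
  rw [ENNReal.ofReal_prod_of_nonneg fun i _ => hA _ _]
  rfl

end Matrix

/-- The excluded case is `0` to a negative power: `0` in `ℝ`, `∞` in `ℝ≥0∞`. -/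
theorem ENNReal.ofReal_rpow_of_nonneg_of_pos_or {x p : ℝ} (hx : 0 ≤ x) (h : 0 < x ∨ 0 ≤ p) :
    ENNReal.ofReal x ^ p = ENNReal.ofReal (x ^ p) :=
  h.elim ENNReal.ofReal_rpow_of_pos (ENNReal.ofReal_rpow_of_nonneg hx)

/-- The first conjunct is the inequality between real numbers, wherever both sides are finite.
The second is the inequality in `[0, ∞]` for every doubly stochastic `β`, where `0 ^ (-γ) = ∞` for
`γ > 0`, so that an entry `β i j = 1` is allowed as well. -/
theorem mainTheorem4 (n : ℕ) (β : Matrix (Fin n) (Fin n) ℝ)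
    (hβ : β ∈ doublyStochastic ℝ (Fin n)) (γ : ℝ) (hγ : γ ∈ Set.Icc (-1 : ℝ) 1) :
    ((γ ≤ 0 ∨ ∀ i j, β i j ≠ 1) →
      (Matrix.of fun i j => β i j * (1 - β i j) ^ (-γ)).permanent ≥
        ((n ! : ℝ) / (n : ℝ) ^ n) * ∏ i, ∏ j, (1 - β i j) ^ (-γ * β i j)) ∧
    (Matrix.of fun i j =>
        ENNReal.ofReal (β i j) * ENNReal.ofReal (1 - β i j) ^ (-γ)).permanent ≥
      ((n ! : ℝ≥0∞) / (n : ℝ≥0∞) ^ n) *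
        ∏ i, ∏ j, ENNReal.ofReal (1 - β i j) ^ (-γ * β i j) := by
  have hreal := Matrix.prod_prod_rpow_le_permanent hβ γ
  refine ⟨fun _ => hreal, ?_⟩
  have h0 : ∀ i j, 0 ≤ β i j := fun i j => nonneg_of_mem_doublyStochastic hβ
  have h1 : ∀ i j, 0 ≤ 1 - β i j := fun i j => sub_nonneg.mpr (le_one_of_mem_doublyStochastic hβ)
  by_cases hfin : γ ≤ 0 ∨ ∀ i j, β i j ≠ 1
  · have hor : ∀ i j, 0 < 1 - β i j ∨ γ ≤ 0 := fun i j => hfin.symm.imp_left fun h =>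
      (h1 i j).lt_of_ne' (sub_ne_zero.mpr (h i j).symm)
    have hentry : ∀ i j, ENNReal.ofReal (β i j) * ENNReal.ofReal (1 - β i j) ^ (-γ) =
        ENNReal.ofReal (β i j * (1 - β i j) ^ (-γ)) := fun i j => by
      rw [ENNReal.ofReal_mul (h0 i j), ENNReal.ofReal_rpow_of_nonneg_of_pos_or (h1 i j)
        ((hor i j).imp_right neg_nonneg.mpr)]
    have hpow : ∀ i j, ENNReal.ofReal (1 - β i j) ^ (-γ * β i j) =
        ENNReal.ofReal ((1 - β i j) ^ (-γ * β i j)) := fun i j =>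
      ENNReal.ofReal_rpow_of_nonneg_of_pos_or (h1 i j)
        ((hor i j).imp_right fun h => mul_nonneg (neg_nonneg.mpr h) (h0 i j))
    have hconst : (n ! : ℝ≥0∞) / (n : ℝ≥0∞) ^ n = ENNReal.ofReal ((n ! : ℝ) / (n : ℝ) ^ n) := by
      rcases Nat.eq_zero_or_pos n with rfl | hn
      · simp
      · rw [ENNReal.ofReal_div_of_pos (by positivity), ENNReal.ofReal_pow (by positivity),
          ENNReal.ofReal_natCast, ENNReal.ofReal_natCast]
    have hprod : ∏ i, ∏ j, ENNReal.ofReal (1 - β i j) ^ (-γ * β i j) =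
        ENNReal.ofReal (∏ i, ∏ j, (1 - β i j) ^ (-γ * β i j)) := by
      rw [ENNReal.ofReal_prod_of_nonneg fun i _ =>
        Finset.prod_nonneg fun j _ => Real.rpow_nonneg (h1 i j) _]
      refine Finset.prod_congr rfl fun i _ => ?_
      rw [ENNReal.ofReal_prod_of_nonneg fun j _ => Real.rpow_nonneg (h1 i j) _]
      exact Finset.prod_congr rfl fun j _ => hpow i j
    have hperm := Matrix.ofReal_permanent
      (A := Matrix.of fun i j => β i j * (1 - β i j) ^ (-γ))
      fun i j => mul_nonneg (h0 i j) (Real.rpow_nonneg (h1 i j) _)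
    simp only [Matrix.of_apply] at hperm
    simp only [hentry]
    rw [hconst, hprod, ← ENNReal.ofReal_mul (by positivity), ← hperm]
    exact ENNReal.ofReal_le_ofReal hreal
  · push Not at hfin
    obtain ⟨hγ0, i, j, hij⟩ := hfin
    rw [Matrix.permanent_eq_top_of_eq_one hβ hγ0 hij]
    exact le_top
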